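/- Let the $5\times n$ grid graph have vertex set $\{0,\dots,n-1\}\times\{0,\dots,4\}$, with an edge between any two points at distance $1$. A growing self-avoiding walk (GSAW) on a graph is a directed walk that visits no vertex twice and whose endpoint is trapped, i.e. every neighbour of the endpoint has been visited. A Greek key tour on the $5\times n$ grid graph is a GSAW that starts in the upper-left corner $(0,4)$ and visits every vertex. Let $g_{5,n}$ be the number of Greek key tours on the $5\times n$ grid graph, with the convention $g_{5,0}=1$ (the empty tour of the empty grid), and let $G_5(x)=\sum_{n\ge 0} g_{5,n}x^n$ as a formal power series. Then $$G_5(x)=\frac{1-3x-13x^2+58x^3+25x^4-162x^5+63x^6+113x^7-61x^8+12x^9-11x^{10}+25x^{11}-17x^{12}+5x^{13}-3x^{14}}{(1+x)(1-11x^2-2x^6)(1-5x+2x^2+8x^3-8x^4+x^5-x^6)}$$ $$=1+x+5x^2+38x^3+160x^4+824x^5+\cdots.$$ Consequently (confirming Barker's conjecture on OEIS A145156), $a(n)=g_{5,n}$ satisfies, for all $n\ge 15$, $$a(n)=4a(n-1)+14a(n-2)-54a(n-3)-33a(n-4)+117a(n-5)+2a(n-6)-84a(n-7)-6a(n-8)+9a(n-9)-14a(n-11)-2a(n-13).$$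 -/

import Mathlib

/-- The grid graph on a set `S` of integer points of the plane: two points are adjacent exactly
when their Euclidean distance is `1`. -/
def gridGraph (S : Set (ℤ × ℤ)) : SimpleGraph S where
  Adj p q := (p.1.1 - q.1.1) ^ 2 + (p.1.2 - q.1.2) ^ 2 = 1
  symm := ⟨fun p q h => by
    rw [← h]
    ring⟩
  loopless := ⟨fun p h => by simp at h⟩

/-- A growing self-avoiding walk on `G`, given by its list of vertices in order: consecutive
vertices are adjacent, no vertex is visited twice, and the endpoint is trapped, that is, all its
neighbours have been visited. (The empty list is let through; see `IsGreekKeyTour`.) -/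
def IsGSAW {V : Type*} (G : SimpleGraph V) (w : List V) : Prop :=
  w.IsChain G.Adj ∧ w.Nodup ∧ ∀ v ∈ w.getLast?, ∀ u, G.Adj v u → u ∈ w

/-- The points of the `k × n` grid, of height `k` and width `n`: `{0, …, n-1} × {0, …, k-1}`. -/
def gridPoints (k n : ℕ) : Set (ℤ × ℤ) :=
  {p | 0 ≤ p.1 ∧ p.1 < n ∧ 0 ≤ p.2 ∧ p.2 < k}

/-- A Greek key tour of the `k × n` grid: a growing self-avoiding walk on the finite grid graph
that starts in the upper-left corner `(0, k-1)` and visits every vertex.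
For `k, n ≥ 1` the list is nonempty, since it contains every vertex. The grid with `n = 0` columns
has exactly one tour, the empty one, so that the generating function has constant term `1`. -/
def IsGreekKeyTour (k n : ℕ) (w : List (gridPoints k n)) : Prop :=
  IsGSAW (gridGraph (gridPoints k n)) w ∧
    (∀ v ∈ w.head?, (v : ℤ × ℤ) = (0, (k : ℤ) - 1)) ∧
    ∀ v, v ∈ w

/-- The number `g_{k,n}` of Greek key tours of the `k × n` grid. -/
noncomputable def greekKeyCount (k n : ℕ) : ℕ :=
  {w : List (gridPoints k n) | IsGreekKeyTour k n w}.ncard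

/-- The generating function `G_k(x) = ∑ₙ g_{k,n} xⁿ`, as a formal power series over `ℚ`. -/
noncomputable def greekKeySeries (k : ℕ) : PowerSeries ℚ :=
  PowerSeries.mk fun n => (greekKeyCount k n : ℚ)

/-! A tour is turned into a word `0, cells, 1`. The artificial last entry `1` may follow every cell,
because a tour may stop anywhere: it covers the grid, so its endpoint is trapped automatically. The
entry `0` is tied to the corner cell by a required pair.

Cells are then eliminated one at a time in column order. If the first cell `v` stands between `a`
and `b`, deleting it gives a word on fewer cells in which `s(a, b)` must be consecutive. Since the
entries are distinct, this pair marks the only place where `v` can be put back, so words are counted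
exactly by summing over the possible neighbours of `v` (`wordCount_eq_sum`, `stripCount_succ`). The
required pairs record how the eliminated part of the walk connects what remains. Relabelling after
each deletion keeps them in a bounded window, so finitely many states occur at column boundaries.

Grouping these states into classes with equal numbers of completions gives a small transfer matrix.
A finite computation checks that the grouping respects elimination (`stateTable_column`,
`stripCount_eq_completions`). The recurrence is checked for every class at the start and propagates
because the transfer is linear (`recurrenceDefect_completions`). Together with the first fifteen
values it determines the generating function. -/

/-! ### Words with required adjacencies, and deletion of an entry. -/

section Words

variable {α : Type*}

/-- The unordered pairs of consecutive entries of a list. -/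
def edges : List α → List (Sym2 α)
  | [] => []
  | [_] => []
  | a :: b :: l => s(a, b) :: edges (b :: l)

theorem edges_append_cons (p : List α) (a : α) (q : List α) :
    edges (p ++ a :: q) = edges (p ++ [a]) ++ edges (a :: q) := by
  induction p with
  | nil => simp [edges]
  | cons x p ih =>
    cases p with
    | nil => simp [edges]
    | cons y p => simpa [edges] using ih

theorem edges_append_cons_cons (p : List α) (a b : α) (q : List α) :
    edges (p ++ a :: b :: q) = edges (p ++ [a]) ++ s(a, b) :: edges (b :: q) := by
  rw [edges_append_cons]; rfl

theorem exists_append_of_mem_edges {l : List α} {z : Sym2 α} (h : z ∈ edges l) :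
    ∃ p a b q, l = p ++ a :: b :: q ∧ z = s(a, b) := by
  induction l with
  | nil => simp [edges] at h
  | cons x l ih =>
    cases l with
    | nil => simp [edges] at h
    | cons y l =>
      rcases List.mem_cons.1 h with h | h
      · exact ⟨[], x, y, l, rfl, h⟩
      · obtain ⟨p, a, b, q, hl, hz⟩ := ih h
        exact ⟨x :: p, a, b, q, by rw [hl]; rfl, hz⟩

theorem mem_of_mem_edges {l : List α} {z : Sym2 α} (h : z ∈ edges l) {x : α} (hx : x ∈ z) :
    x ∈ l := by
  obtain ⟨p, a, b, q, rfl, rfl⟩ := exists_append_of_mem_edges h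
  rcases Sym2.mem_iff.1 hx with rfl | rfl <;> simp

theorem edges_map {β : Type*} (f : α → β) (l : List α) :
    edges (l.map f) = (edges l).map (Sym2.map f) := by
  induction l with
  | nil => rfl
  | cons x l ih =>
    cases l with
    | nil => rfl
    | cons y l => simpa [edges] using ih

theorem isChain_iff_forall_edges {l : List α} {r : α → α → Prop} {A : Set (Sym2 α)}
    (hr : ∀ x y, r x y ↔ s(x, y) ∈ A) : l.IsChain r ↔ ∀ z ∈ edges l, z ∈ A := by
  induction l with
  | nil => simp [edges]
  | cons x l ih =>
    cases l with
    | nil => simp [edges]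
    | cons y l => simp [edges, ih, hr]

/-- `l` lists the set `U` without repetition, from `s` to `e`, with consecutive entries joined by
`A` or by `M`, and every pair of `M` is consecutive in `l`. -/
structure IsWord (s e : α) (U : Set α) (A M : Set (Sym2 α)) (l : List α) : Prop where
  nodup : l.Nodup
  mem : ∀ x, x ∈ l ↔ x ∈ U
  head : l.head? = some s
  last : l.getLast? = some e
  edge : ∀ z ∈ edges l, z ∈ A ∪ M
  req : ∀ z ∈ M, z ∈ edges l

/-- The number of words. -/
noncomputable def wordCount (s e : α) (U : Set α) (A M : Set (Sym2 α)) : ℕ :=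
  {l | IsWord s e U A M l}.ncard

theorem finite_setOf_isWord {s e : α} {U : Set α} (hU : U.Finite) {A M : Set (Sym2 α)} :
    {l | IsWord s e U A M l}.Finite := by
  classical
  have : Fintype U := hU.fintype
  have hfin : {l : List U | l.Nodup}.Finite :=
    (inferInstance : Finite {l : List U // l.Nodup})
  refine (hfin.image (List.map Subtype.val)).subset ?_
  intro l hl
  have hl' : ∀ x ∈ l, x ∈ U := fun x hx => (hl.mem x).1 hx
  lift l to List U using hl'
  exact ⟨l, hl.nodup.of_map, rfl⟩

theorem IsWord.exists_eq_append {s e v : α} {U : Set α} {A M : Set (Sym2 α)} {l : List α}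
    (hl : IsWord s e U A M l) (hv : v ∈ U) (hs : v ≠ s) (he : v ≠ e) :
    ∃ p a b q, l = p ++ a :: v :: b :: q := by
  obtain ⟨p, q, rfl⟩ := List.append_of_mem ((hl.mem v).2 hv)
  rcases List.eq_nil_or_concat p with rfl | ⟨p, a, rfl⟩
  · exact absurd (by simpa using hl.head) hs
  · cases q with
    | nil => exact absurd (by simpa using hl.last) he
    | cons b q => exact ⟨p, a, b, q, by simp⟩

/-- The pair of neighbours of an interior entry in a list without repetition. -/
theorem neighbours_unique {p p' q q' : List α} {a a' b b' v : α}
    (hn : (p ++ a :: v :: b :: q).Nodup)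
    (h : p ++ a :: v :: b :: q = p' ++ a' :: v :: b' :: q') :
    p = p' ∧ a = a' ∧ b = b' ∧ q = q' := by
  have hn' := h ▸ hn
  have h1 : (p ++ [a]) ++ v :: (b :: q) = (p' ++ [a']) ++ v :: (b' :: q') := by simpa using h
  have h2 : v ∉ p ++ [a] := by
    simp [List.nodup_append] at hn ⊢; grind
  have h3 : v ∉ b :: q := by
    simp [List.nodup_append] at hn ⊢; grind
  have h2' : v ∉ p' ++ [a'] := by
    simp [List.nodup_append] at hn' ⊢; grind
  obtain ⟨e1, -, e2⟩ := (List.append_cons_inj_of_notMem h2 h3).1 h1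
  have := List.append_inj' e1 rfl
  simp at this e2
  tauto

/-- An unordered pair of consecutive entries fixes both its position and its orientation: occurring
in the reverse order as well would force a repeated entry. This makes reinsertion of a deleted entry
unambiguous. -/
theorem eq_of_append_cons_cons_eq {p p' q q' : List α} {a a' b b' : α}
    (hn : (p ++ a :: b :: q).Nodup) (h : p ++ a :: b :: q = p' ++ a' :: b' :: q')
    (hz : s(a, b) = s(a', b')) : p = p' ∧ a = a' ∧ b = b' ∧ q = q' := by
  have h2 : a ∉ p := by
    simp [List.nodup_append] at hn ⊢; grind
  have h3 : a ∉ b :: q := by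
    simp [List.nodup_append] at hn ⊢; grind
  rcases Sym2.eq_iff.1 hz with ⟨rfl, rfl⟩ | ⟨rfl, rfl⟩
  · obtain ⟨e1, -, e2⟩ := (List.append_cons_inj_of_notMem h2 h3).1 h
    simp at e2
    exact ⟨e1, rfl, rfl, e2⟩
  · have h' : p ++ a :: (b :: q) = (p' ++ [b]) ++ a :: q' := by simpa using h
    obtain ⟨e1, -, e2⟩ := (List.append_cons_inj_of_notMem h2 h3).1 h'
    subst e1
    simp [List.nodup_append] at hn

section Deletion

variable {s e v a b : α} {U : Set α} {A M : Set (Sym2 α)} {p q : List α}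

theorem mem_edges_insert_iff {z : Sym2 α} :
    z ∈ edges (p ++ a :: v :: b :: q) ↔
      z ∈ edges (p ++ [a]) ∨ z = s(a, v) ∨ z = s(v, b) ∨ z ∈ edges (b :: q) := by
  rw [edges_append_cons_cons]
  simp [edges]

theorem mem_edges_delete_iff {z : Sym2 α} :
    z ∈ edges (p ++ a :: b :: q) ↔
      z ∈ edges (p ++ [a]) ∨ z = s(a, b) ∨ z ∈ edges (b :: q) := by
  rw [edges_append_cons_cons]
  simp

/-- Deleting an entry `v` with neighbours `a`, `b` makes the pair `s(a, b)` a required one. -/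
theorem isWord_delete_iff (hvU : v ∈ U) (hvs : v ≠ s) (hve : v ≠ e)
    (hM : s(a, b) ∉ M) (hreq : ∀ x, s(v, x) ∈ M → x ∈ s(a, b))
    (hadj : ∀ x ∈ s(a, b), s(v, x) ∈ A ∪ M) (hv : v ∉ p ++ a :: b :: q) :
    IsWord s e U A M (p ++ a :: v :: b :: q) ↔
      IsWord s e (U \ {v}) A (insert s(a, b) {z ∈ M | v ∉ z}) (p ++ a :: b :: q) := by
  have hnod : (p ++ a :: v :: b :: q).Nodup ↔ (p ++ a :: b :: q).Nodup := by
    have : (p ++ a :: v :: b :: q).Perm (v :: (p ++ a :: b :: q)) := by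
      simpa using List.perm_middle (l₁ := p ++ [a]) (l₂ := b :: q) (a := v)
    rw [this.nodup_iff, List.nodup_cons]
    tauto
  have hhead : (p ++ a :: v :: b :: q).head? = (p ++ a :: b :: q).head? := by
    cases p <;> rfl
  have hlast : (p ++ a :: v :: b :: q).getLast? = (p ++ a :: b :: q).getLast? := by
    simp [List.getLast?_append]
  have hmem : (∀ x, x ∈ p ++ a :: v :: b :: q ↔ x ∈ U) ↔
      ∀ x, x ∈ p ++ a :: b :: q ↔ x ∈ U \ {v} := by
    simp only [List.mem_append, List.mem_cons, Set.mem_sdiff, Set.mem_singleton_iff] at hv ⊢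
    refine forall_congr' fun x => ?_
    by_cases hx : x = v
    · subst hx; tauto
    · simp [hx]
  have hvX : ∀ z ∈ edges (p ++ [a]), v ∉ z := fun z hz h => by
    have := mem_of_mem_edges hz h
    simp at this hv; tauto
  have hvY : ∀ z ∈ edges (b :: q), v ∉ z := fun z hz h => by
    have := mem_of_mem_edges hz h
    simp at this hv; tauto
  have hva : v ≠ a := by rintro rfl; simp at hv
  have hvb : v ≠ b := by rintro rfl; simp at hv
  -- Absence of repetitions ensures that `s(a, b)` is consecutive only at the splice, so allowing it
  -- as a new pair licenses nothing elsewhere in the list.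
  have key : (p ++ a :: b :: q).Nodup →
      ((∀ z ∈ edges (p ++ a :: v :: b :: q), z ∈ A ∪ M) ∧
        (∀ z ∈ M, z ∈ edges (p ++ a :: v :: b :: q)) ↔
      (∀ z ∈ edges (p ++ a :: b :: q), z ∈ A ∪ insert s(a, b) {z ∈ M | v ∉ z}) ∧
        ∀ z ∈ insert s(a, b) {z ∈ M | v ∉ z}, z ∈ edges (p ++ a :: b :: q)) := by
    intro hn
    have haX : s(a, b) ∉ edges (p ++ [a]) := fun h => by
      have := mem_of_mem_edges h (Sym2.mem_mk_right a b)
      simp [List.nodup_append] at this hn; grind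
    have haY : s(a, b) ∉ edges (b :: q) := fun h => by
      have := mem_of_mem_edges h (Sym2.mem_mk_left a b)
      simp [List.nodup_append] at this hn; grind
    constructor
    · rintro ⟨h1, h2⟩
      refine ⟨fun z hz => ?_, fun z hz => ?_⟩
      · rw [mem_edges_delete_iff] at hz
        have h3 := h1 z
        rw [mem_edges_insert_iff] at h3
        rcases hz with hz | rfl | hz
        · rcases h3 (by tauto) with h | h
          · exact Or.inl h
          · exact Or.inr (Or.inr ⟨h, hvX z hz⟩)
        · exact Or.inr (Or.inl rfl)
        · rcases h3 (by tauto) with h | h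
          · exact Or.inl h
          · exact Or.inr (Or.inr ⟨h, hvY z hz⟩)
      · rw [mem_edges_delete_iff]
        rcases hz with rfl | ⟨hz, hzv⟩
        · tauto
        · rcases mem_edges_insert_iff.1 (h2 z hz) with h | rfl | rfl | h
          · tauto
          · simp at hzv
          · simp at hzv
          · tauto
    · rintro ⟨h1, h2⟩
      refine ⟨fun z hz => ?_, fun z hz => ?_⟩
      · rw [mem_edges_insert_iff] at hz
        have h3 := h1 z
        rw [mem_edges_delete_iff] at h3
        rcases hz with hz | rfl | rfl | hz
        · rcases h3 (by tauto) with h | rfl | h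
          · exact Or.inl h
          · exact absurd hz haX
          · exact Or.inr h.1
        · rw [Sym2.eq_swap]; exact hadj a (by simp)
        · exact hadj b (by simp)
        · rcases h3 (by tauto) with h | rfl | h
          · exact Or.inl h
          · exact absurd hz haY
          · exact Or.inr h.1
      · rw [mem_edges_insert_iff]
        by_cases hzv : v ∈ z
        · obtain ⟨x, rfl⟩ := hzv
          rcases Sym2.mem_iff.1 (hreq x hz) with rfl | rfl
          · right; left; exact Sym2.eq_swap
          · tauto
        · rcases mem_edges_delete_iff.1 (h2 z (Or.inr ⟨hz, hzv⟩)) with h | rfl | h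
          · tauto
          · exact absurd hz hM
          · tauto
  constructor
  · rintro ⟨h1, h2, h3, h4, h5, h6⟩
    have hn := hnod.1 h1
    obtain ⟨h7, h8⟩ := (key hn).1 ⟨h5, h6⟩
    exact ⟨hn, hmem.1 h2, hhead ▸ h3, hlast ▸ h4, h7, h8⟩
  · rintro ⟨h1, h2, h3, h4, h5, h6⟩
    obtain ⟨h7, h8⟩ := (key h1).2 ⟨h5, h6⟩
    exact ⟨hnod.2 h1, hmem.2 h2, hhead ▸ h3, hlast ▸ h4, h7, h8⟩

variable [DecidableEq α]

theorem erase_middle (hn : (p ++ a :: v :: b :: q).Nodup) :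
    (p ++ a :: v :: b :: q).erase v = p ++ a :: b :: q := by
  have h : v ∉ p ++ [a] := by
    simp [List.nodup_append] at hn ⊢; grind
  have := List.erase_append_right (v :: b :: q) h
  simpa using this

/-- Erasing `v` is the bijection. It is injective because `z` marks the place of reinsertion, and
surjective because `z` is required, hence present, in every shorter word. -/
theorem ncard_isWord_through (hvU : v ∈ U) (hvs : v ≠ s) (hve : v ≠ e) {z : Sym2 α}
    (hM : z ∉ M) (hreq : ∀ x, s(v, x) ∈ M → x ∈ z) (hadj : ∀ x ∈ z, s(v, x) ∈ A ∪ M) :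
    {l | IsWord s e U A M l ∧ ∃ p a b q, l = p ++ a :: v :: b :: q ∧ z = s(a, b)}.ncard =
      wordCount s e (U \ {v}) A (insert z {y ∈ M | v ∉ y}) := by
  refine Set.ncard_congr (fun l _ => l.erase v) ?_ ?_ ?_
  · rintro _ ⟨hl, p, a, b, q, rfl, rfl⟩
    have hn := hl.nodup
    rw [erase_middle hn]
    refine (isWord_delete_iff hvU hvs hve hM hreq hadj ?_).1 hl
    rw [← erase_middle hn]
    exact hn.not_mem_erase
  · rintro _ _ ⟨hl, p, a, b, q, rfl, rfl⟩ ⟨hl', p', a', b', q', rfl, hz⟩ h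
    rw [erase_middle hl.nodup, erase_middle hl'.nodup] at h
    have hn : (p ++ a :: b :: q).Nodup := by
      rw [← erase_middle hl.nodup]; exact hl.nodup.erase v
    obtain ⟨rfl, rfl, rfl, rfl⟩ := eq_of_append_cons_cons_eq hn h hz
    rfl
  · intro l hl
    obtain ⟨p, a, b, q, rfl, rfl⟩ := exists_append_of_mem_edges (hl.req z (Or.inl rfl))
    have hv : v ∉ p ++ a :: b :: q := fun h => ((hl.mem v).1 h).2 rfl
    have hw := (isWord_delete_iff hvU hvs hve hM hreq hadj hv).2 hl
    exact ⟨_, ⟨hw, p, a, b, q, rfl, rfl⟩, erase_middle hw.nodup⟩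

/-- Elimination of `v`: words are counted according to the pair of neighbours of `v`. -/
theorem wordCount_eq_sum (hU : U.Finite) (hvU : v ∈ U) (hvs : v ≠ s) (hve : v ≠ e)
    (Z : Finset (Sym2 α))
    (hZ : ∀ p a b q, IsWord s e U A M (p ++ a :: v :: b :: q) → s(a, b) ∈ Z)
    (hM : ∀ z ∈ Z, z ∉ M) (hreq : ∀ z ∈ Z, ∀ x, s(v, x) ∈ M → x ∈ z)
    (hadj : ∀ z ∈ Z, ∀ x ∈ z, s(v, x) ∈ A ∪ M) :
    wordCount s e U A M =
      ∑ z ∈ Z, wordCount s e (U \ {v}) A (insert z {y ∈ M | v ∉ y}) := by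
  classical
  have hfin := finite_setOf_isWord (s := s) (e := e) hU (A := A) (M := M)
  rw [← Finset.sum_congr rfl fun z hz =>
    ncard_isWord_through hvU hvs hve (hM z hz) (hreq z hz) (hadj z hz)]
  have hunion : {l | IsWord s e U A M l} = ⋃ z ∈ (Z : Set (Sym2 α)),
      {l | IsWord s e U A M l ∧ ∃ p a b q, l = p ++ a :: v :: b :: q ∧ z = s(a, b)} := by
    ext l
    constructor
    · intro hl
      obtain ⟨p, a, b, q, rfl⟩ := IsWord.exists_eq_append hl hvU hvs hve
      exact Set.mem_biUnion (Finset.mem_coe.2 (hZ p a b q hl)) ⟨hl, p, a, b, q, rfl, rfl⟩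
    · intro hl
      obtain ⟨z, -, hl, -⟩ := Set.mem_iUnion₂.1 hl
      exact hl
  rw [wordCount, hunion, Set.Finite.ncard_biUnion Z.finite_toSet, finsum_mem_coe_finset]
  · exact fun z _ => hfin.subset fun l hl => hl.1
  · intro z _ z' _ hzz
    refine Set.disjoint_left.2 ?_
    rintro _ ⟨hl, p, a, b, q, rfl, rfl⟩ ⟨-, p', a', b', q', h, rfl⟩
    obtain ⟨-, rfl, rfl, -⟩ := neighbours_unique hl.nodup h
    exact hzz rfl

end Deletion

/-- In a list without repetition an entry has at most two neighbours. -/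
theorem not_three_neighbours {l : List α} (hn : l.Nodup) {x y₁ y₂ y₃ : α}
    (h₁ : s(x, y₁) ∈ edges l) (h₂ : s(x, y₂) ∈ edges l) (h₃ : s(x, y₃) ∈ edges l) :
    y₁ = y₂ ∨ y₁ = y₃ ∨ y₂ = y₃ := by
  classical
  -- The index of a neighbour differs from that of `x` by one, which leaves only two values.
  have key : ∀ y, s(x, y) ∈ edges l →
      y ∈ l ∧ (l.idxOf y = l.idxOf x + 1 ∨ l.idxOf x = l.idxOf y + 1) := by
    intro y hy
    refine ⟨mem_of_mem_edges hy (by simp), ?_⟩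
    obtain ⟨p, a, b, q, rfl, hz⟩ := exists_append_of_mem_edges hy
    have ha : a ∉ p := by simp [List.nodup_append] at hn ⊢; grind
    have hb : b ∉ p := by simp [List.nodup_append] at hn ⊢; grind
    have hab : a ≠ b := by simp [List.nodup_append] at hn ⊢; grind
    rcases Sym2.eq_iff.1 hz with ⟨rfl, rfl⟩ | ⟨rfl, rfl⟩
    · left; rw [List.idxOf_append_of_notMem ha, List.idxOf_append_of_notMem hb]
      simp [List.idxOf_cons_ne _ hab]
    · right; rw [List.idxOf_append_of_notMem ha, List.idxOf_append_of_notMem hb]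
      simp [List.idxOf_cons_ne _ hab]
  obtain ⟨m₁, k₁⟩ := key _ h₁
  obtain ⟨m₂, k₂⟩ := key _ h₂
  obtain ⟨m₃, k₃⟩ := key _ h₃
  rw [← List.idxOf_inj m₁ , ← List.idxOf_inj m₁, ← List.idxOf_inj m₂]
  omega

/-- The last entry of a list without repetition has at most one neighbour. -/
theorem neighbour_last_unique {l : List α} (hn : l.Nodup) {e y₁ y₂ : α}
    (he : l.getLast? = some e)
    (h₁ : s(e, y₁) ∈ edges l) (h₂ : s(e, y₂) ∈ edges l) : y₁ = y₂ := by
  obtain ⟨l, rfl⟩ := List.getLast?_eq_some_iff.1 he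
  have key : ∀ y, s(e, y) ∈ edges (l ++ [e]) → l.getLast? = some y := by
    intro y hy
    rcases List.eq_nil_or_concat l with rfl | ⟨p, a, rfl⟩
    · simp [edges] at hy
    · have he' : e ∉ p ++ [a] := by simp [List.nodup_append] at hn ⊢; grind
      have h : s(e, y) ∈ edges (p ++ a :: e :: []) := by simpa using hy
      rw [edges_append_cons_cons] at h
      rcases List.mem_append.1 h with h | h
      · exact absurd (mem_of_mem_edges h (by simp)) he'
      · simp [edges] at h
        rcases h with h | h
        · simp [h] at he'
        · simp [h]
  exact Option.some.inj ((key _ h₁).symm.trans (key _ h₂))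

/-- Words are transported by injective relabellings. -/
theorem wordCount_image {β : Type*} {f : α → β} (hf : f.Injective) {s e : α} {U : Set α}
    {A M : Set (Sym2 α)} {B : Set (Sym2 β)} (hB : ∀ z, Sym2.map f z ∈ B ↔ z ∈ A) :
    wordCount (f s) (f e) (f '' U) B (Sym2.map f '' M) = wordCount s e U A M := by
  unfold wordCount
  rw [← Set.ncard_image_of_injective _ (List.map_injective_iff.2 hf)]
  congr 1
  have hF := Sym2.map.injective hf
  have key : ∀ l : List α, IsWord (f s) (f e) (f '' U) B (Sym2.map f '' M) (l.map f) ↔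
      IsWord s e U A M l := by
    intro l
    have hmem : (∀ x, x ∈ l.map f ↔ x ∈ f '' U) ↔ ∀ x, x ∈ l ↔ x ∈ U := by
      constructor
      · intro h x
        have := h (f x)
        rwa [hf.mem_set_image, List.mem_map_of_injective hf] at this
      · intro h x
        simp [h]
    constructor
    · rintro ⟨h1, h2, h3, h4, h5, h6⟩
      refine ⟨h1.of_map, hmem.1 h2, ?_, ?_, fun z hz => ?_, fun z hz => ?_⟩
      · simpa [hf.eq_iff] using h3
      · simpa [hf.eq_iff] using h4
      · have := h5 (Sym2.map f z) (by rw [edges_map]; exact List.mem_map_of_mem hz)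
        rwa [Set.mem_union, hB, hF.mem_set_image] at this
      · have := h6 _ (Set.mem_image_of_mem _ hz)
        rwa [edges_map, List.mem_map_of_injective hF] at this
    · rintro ⟨h1, h2, h3, h4, h5, h6⟩
      refine ⟨h1.map hf, hmem.2 h2, by simp [h3], by simp [h4], fun z hz => ?_, ?_⟩
      · rw [edges_map] at hz
        obtain ⟨y, hy, rfl⟩ := List.mem_map.1 hz
        rw [Set.mem_union, hB, hF.mem_set_image]
        exact h5 y hy
      · rintro _ ⟨z, hz, rfl⟩
        rw [edges_map]
        exact List.mem_map_of_mem (h6 z hz)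
  ext l
  constructor
  · intro hl
    -- A word on `f '' U` has all its entries in the range of `f`, so it lifts to a list over `α`.
    have : l ∈ Set.range (List.map f) := by
      rw [Set.range_list_map]
      exact fun x hx => Set.image_subset_range f U ((hl.mem x).1 hx)
    obtain ⟨l, rfl⟩ := this
    exact ⟨l, (key l).1 hl, rfl⟩
  · rintro ⟨l, hl, rfl⟩
    exact (key l).2 hl

end Words

/-! ### Elimination of the cells of a strip of height five. -/

section Elimination

/-- Adjacency for words of cells of a strip of height `5`. The cells in column order are coded by
`2, 3, …`, the first of them being in row `j` modulo `5`; `0` and `1` are the two ends of a word, and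
`1` may follow every cell. -/
def StripAdj (j x y : ℕ) : Prop :=
  x = 1 ∨ y = 1 ∨ 2 ≤ x ∧ 2 ≤ y ∧
    (y = x + 5 ∨ x = y + 5 ∨ (y = x + 1 ∧ (x - 2 + j) % 5 ≠ 4) ∨ (x = y + 1 ∧ (y - 2 + j) % 5 ≠ 4))

theorem stripAdj_symm (j : ℕ) : Std.Symm (StripAdj j) :=
  ⟨fun x y h => by unfold StripAdj at *; tauto⟩

/-- The pairs joined by `StripAdj`. -/
def stripPairs (j : ℕ) : Set (Sym2 ℕ) := {z | ∃ x y, z = s(x, y) ∧ StripAdj j x y}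

theorem mk_mem_stripPairs {j x y : ℕ} : s(x, y) ∈ stripPairs j ↔ StripAdj j x y := by
  constructor
  · rintro ⟨a, b, hz, h⟩
    rcases Sym2.eq_iff.1 hz with ⟨rfl, rfl⟩ | ⟨rfl, rfl⟩
    · exact h
    · exact (stripAdj_symm j).symm _ _ h
  · exact fun h => ⟨x, y, rfl, h⟩

/-- The set of unordered pairs in a list of pairs. -/
def pairSet (M : List (ℕ × ℕ)) : Set (Sym2 ℕ) := {z | ∃ p ∈ M, z = s(p.1, p.2)}

/-- The number of words on `N` cells that start in row `j` and contain all pairs of `M`. -/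
noncomputable def stripCount (j N : ℕ) (M : List (ℕ × ℕ)) : ℕ :=
  wordCount 0 1 {x | x < N + 2} (stripPairs j) (pairSet M)

theorem stripPairs_add_five (j : ℕ) : stripPairs (j + 5) = stripPairs j := by
  have (x y : ℕ) : StripAdj (j + 5) x y ↔ StripAdj j x y := by
    unfold StripAdj; simp [← add_assoc]
  simp [stripPairs, this]

theorem stripCount_add_five (j N : ℕ) (M : List (ℕ × ℕ)) :
    stripCount (j + 5) N M = stripCount j N M := by
  rw [stripCount, stripPairs_add_five]; rfl

/-- The partners of `x` in a list of pairs. -/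
def mates (M : List (ℕ × ℕ)) (x : ℕ) : List ℕ :=
  M.filterMap fun p => if p.1 = x then some p.2 else if p.2 = x then some p.1 else none

theorem mem_mates {M : List (ℕ × ℕ)} {x y : ℕ} : y ∈ mates M x ↔ s(x, y) ∈ pairSet M := by
  simp only [mates, List.mem_filterMap, pairSet]
  refine exists_congr fun p => and_congr_right fun _ => ?_
  rw [Sym2.eq_iff]
  split_ifs <;> grind

/-- The relabelling of the cells after the elimination of the cell `2`. -/
def shiftDown (x : ℕ) : ℕ := if x < 2 then x else x - 1

/-- The inverse of `shiftDown`. -/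
def shiftUp (x : ℕ) : ℕ := if x < 2 then x else x + 1

theorem shiftUp_injective : shiftUp.Injective := by
  intro x y h
  unfold shiftUp at h
  split_ifs at h <;> omega

theorem shiftUp_shiftDown {x : ℕ} (h : x ≠ 2) : shiftUp (shiftDown x) = x := by
  unfold shiftUp shiftDown
  split_ifs <;> omega

/-- The lexicographic order of pairs. -/
abbrev PairLE (p q : ℕ × ℕ) : Prop := p.1 < q.1 ∨ p.1 = q.1 ∧ p.2 ≤ q.2

/-- The required pairs after the elimination of the cell `2` with the pair `p` of neighbours. -/
def nextPairs (M : List (ℕ × ℕ)) (p : ℕ × ℕ) : List (ℕ × ℕ) :=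
  -- Ordered insertion keeps sorted lists sorted, so that a state has one normal form and can be
  -- looked up in a table.
  ((M.filter fun q => q.1 ≠ 2 ∧ q.2 ≠ 2).orderedInsert PairLE p).map
    fun q => (shiftDown q.1, shiftDown q.2)

/-- The possible neighbours of the cell `2`, where `nb` lists the cells adjacent to it. -/
def candidates (nb : List ℕ) (M : List (ℕ × ℕ)) : List ℕ :=
  (mates M 2 ++ nb.filter (fun x => ∀ y ∈ mates M x, ∀ y' ∈ mates M x, y = y') ++
    if mates M 1 = [] then [1] else []).dedup

/-- The possible pairs of neighbours of the cell `2`. -/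
def choices (nb : List ℕ) (M : List (ℕ × ℕ)) : List (ℕ × ℕ) :=
  ((candidates nb M).product (candidates nb M)).filter fun p =>
    p.1 < p.2 ∧ (∀ x ∈ mates M 2, x = p.1 ∨ x = p.2) ∧ p ∉ M ∧ p.swap ∉ M ∧ p.1 ≠ 2 ∧ p.2 ≠ 2

/-- All outcomes of the elimination of the cell `2`. -/
def eliminate (nb : List ℕ) (M : List (ℕ × ℕ)) : List (List (ℕ × ℕ)) :=
  (choices nb M).map (nextPairs M)

theorem mem_pairSet_iff_mem_or_swap {M : List (ℕ × ℕ)} {p : ℕ × ℕ} :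
    s(p.1, p.2) ∈ pairSet M ↔ p ∈ M ∨ p.swap ∈ M := by
  constructor
  · rintro ⟨q, hq, h⟩
    rcases Sym2.eq_iff.1 h with ⟨h1, h2⟩ | ⟨h1, h2⟩
    · left; rwa [show p = q from Prod.ext h1 h2]
    · right; rwa [show p.swap = q from Prod.ext h2 h1]
  · rintro (h | h)
    · exact ⟨p, h, rfl⟩
    · exact ⟨p.swap, h, Sym2.eq_swap⟩

theorem mem_nextPairs_image {M : List (ℕ × ℕ)} {p : ℕ × ℕ} (h1 : p.1 ≠ 2) (h2 : p.2 ≠ 2) :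
    Sym2.map shiftUp '' pairSet (nextPairs M p) =
      insert s(p.1, p.2) {z ∈ pairSet M | 2 ∉ z} := by
  have hp : ∀ q : ℕ × ℕ, q.1 ≠ 2 → q.2 ≠ 2 →
      Sym2.map shiftUp s(shiftDown q.1, shiftDown q.2) = s(q.1, q.2) := by
    intro q h1 h2
    rw [Sym2.map_mk, shiftUp_shiftDown h1, shiftUp_shiftDown h2]
  ext z
  constructor
  · rintro ⟨_, ⟨_, hr, rfl⟩, rfl⟩
    obtain ⟨q, hq, rfl⟩ := List.mem_map.1 hr
    rw [List.mem_orderedInsert] at hq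
    rcases hq with rfl | hq
    · left; exact hp _ h1 h2
    · obtain ⟨hqM, hq⟩ := List.mem_filter.1 hq
      simp only [decide_eq_true_eq] at hq
      right
      rw [hp _ hq.1 hq.2]
      refine ⟨⟨q, hqM, rfl⟩, ?_⟩
      rw [Sym2.mem_iff]
      rintro (h | h)
      · exact hq.1 h.symm
      · exact hq.2 h.symm
  · rintro (rfl | ⟨⟨q, hq, rfl⟩, hz⟩)
    · refine ⟨_, ⟨_, List.mem_map_of_mem (a := p) ?_, rfl⟩, hp _ h1 h2⟩
      simp
    · rw [Sym2.mem_iff] at hz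
      have hq' : q.1 ≠ 2 ∧ q.2 ≠ 2 := ⟨fun h => hz (Or.inl h.symm), fun h => hz (Or.inr h.symm)⟩
      refine ⟨_, ⟨_, List.mem_map_of_mem (a := q) ?_, rfl⟩, hp _ hq'.1 hq'.2⟩
      rw [List.mem_orderedInsert, List.mem_filter]
      right
      exact ⟨hq, by simpa using hq'⟩

/-- `shiftUp` identifies the strip starting in row `j + 1` with the strip starting in row `j`
deprived of its first cell: it fixes the two ends and preserves adjacency. -/
theorem wordCount_shift (j N : ℕ) {M : List (ℕ × ℕ)} {p : ℕ × ℕ} (h1 : p.1 ≠ 2) (h2 : p.2 ≠ 2) :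
    wordCount 0 1 ({x | x < N + 1 + 2} \ {2}) (stripPairs j)
      (insert s(p.1, p.2) {z ∈ pairSet M | 2 ∉ z}) =
    stripCount (j + 1) N (nextPairs M p) := by
  have hU : {x | x < N + 1 + 2} \ {2} = shiftUp '' {x | x < N + 2} := by
    ext x
    constructor
    · rintro ⟨h1, h2⟩
      refine ⟨shiftDown x, ?_, shiftUp_shiftDown h2⟩
      have h1 : x < N + 1 + 2 := h1
      have h2 : x ≠ 2 := h2
      change shiftDown x < N + 2
      unfold shiftDown; split_ifs <;> omega
    · rintro ⟨y, hy, rfl⟩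
      have hy : y < N + 2 := hy
      change shiftUp y < N + 1 + 2 ∧ ¬ shiftUp y = 2
      unfold shiftUp; split_ifs <;> omega
  rw [← mem_nextPairs_image h1 h2, hU]
  refine wordCount_image shiftUp_injective (s := 0) (e := 1) ?_
  intro z
  induction z with
  | _ x y =>
    rw [Sym2.map_mk, mk_mem_stripPairs, mk_mem_stripPairs]
    unfold StripAdj shiftUp
    split_ifs <;> omega

theorem mem_candidates {nb : List ℕ} {M : List (ℕ × ℕ)} {x : ℕ} :
    x ∈ candidates nb M ↔ s(2, x) ∈ pairSet M ∨
      (x ∈ nb ∧ ∀ y ∈ mates M x, ∀ y' ∈ mates M x, y = y') ∨ x = 1 ∧ mates M 1 = [] := by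
  rw [candidates, List.mem_dedup, List.mem_append, List.mem_append, mem_mates, List.mem_filter,
    decide_eq_true_eq, or_assoc]
  split_ifs with h <;> simp [h]

theorem mem_choices {nb : List ℕ} {M : List (ℕ × ℕ)} {p : ℕ × ℕ} :
    p ∈ choices nb M ↔ (p.1 ∈ candidates nb M ∧ p.2 ∈ candidates nb M) ∧
      p.1 < p.2 ∧ (∀ x, s(2, x) ∈ pairSet M → x = p.1 ∨ x = p.2) ∧
      s(p.1, p.2) ∉ pairSet M ∧ p.1 ≠ 2 ∧ p.2 ≠ 2 := by
  rw [choices, List.mem_filter, decide_eq_true_eq, mem_pairSet_iff_mem_or_swap, not_or]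
  simp only [mem_mates, and_assoc]
  rw [show p ∈ (candidates nb M).product (candidates nb M) ↔
    p.1 ∈ candidates nb M ∧ p.2 ∈ candidates nb M from List.mem_product, and_assoc]

/-- Choices are increasing pairs, so each unordered pair arises once; this lets the sum over a
finset of unordered pairs become a sum over a list. -/
theorem nodup_choices (nb : List ℕ) (M : List (ℕ × ℕ)) :
    ((choices nb M).map fun p => s(p.1, p.2)).Nodup := by
  refine List.Nodup.map_on ?_ (((List.nodup_dedup _).product (List.nodup_dedup _)).filter _)
  intro p hp q hq h
  have hp := (mem_choices.1 hp).2.1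
  have hq := (mem_choices.1 hq).2.1
  rcases Sym2.eq_iff.1 h with ⟨h1, h2⟩ | ⟨h1, h2⟩
  · exact Prod.ext h1 h2
  · omega

/-- A neighbour of the cell `2` in a word is a candidate. -/
theorem IsWord.mem_candidates {j N : ℕ} {nb : List ℕ} {M : List (ℕ × ℕ)}
    (hnb : ∀ x, 2 < x → x < N + 1 + 2 → StripAdj j 2 x → x ∈ nb) {l : List ℕ}
    (hl : IsWord 0 1 {x | x < N + 1 + 2} (stripPairs j) (pairSet M) l) {x : ℕ}
    (hx : s(2, x) ∈ edges l) : x ∈ candidates nb M := by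
  rw [_root_.mem_candidates]
  by_cases hM : s(2, x) ∈ pairSet M
  · exact Or.inl hM
  · right
    have hA : StripAdj j 2 x := mk_mem_stripPairs.1 ((hl.edge _ hx).resolve_right hM)
    have hU : x < N + 1 + 2 := (hl.mem x).1 (mem_of_mem_edges hx (by simp))
    have hx' : s(x, 2) ∈ edges l := by rwa [Sym2.eq_swap]
    by_cases h1 : x = 1
    · subst h1
      -- The last entry `1` has a single neighbour, here `2`, so any required partner of `1` would
      -- be `2`, against `hM`.
      refine Or.inr ⟨rfl, List.eq_nil_iff_forall_not_mem.2 fun y hy => hM ?_⟩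
      rw [mem_mates] at hy
      rw [neighbour_last_unique hl.nodup hl.last hx' (hl.req _ hy), Sym2.eq_swap]
      exact hy
    · refine Or.inl ⟨hnb x ?_ hU hA, fun y hy y' hy' => ?_⟩
      · unfold StripAdj at hA; omega
      · rw [mem_mates] at hy hy'
        -- One of the two places beside `x` is taken by `2`, which is not a required partner; hence
        -- at most one such partner remains.
        rcases not_three_neighbours hl.nodup hx' (hl.req _ hy) (hl.req _ hy') with h | h | h
        · subst h; rw [Sym2.eq_swap] at hy; exact absurd hy hM
        · subst h; rw [Sym2.eq_swap] at hy'; exact absurd hy' hM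
        · exact h

/-- Elimination of the first cell. -/
theorem stripCount_succ (j N : ℕ) (nb : List ℕ) (M : List (ℕ × ℕ))
    (hnb : ∀ x, x ∈ nb ↔ 2 < x ∧ x < N + 1 + 2 ∧ StripAdj j 2 x) :
    stripCount j (N + 1) M = ((eliminate nb M).map (stripCount (j + 1) N)).sum := by
  have hmem : ∀ z, z ∈ ((choices nb M).map fun p => s(p.1, p.2)).toFinset ↔
      ∃ p ∈ choices nb M, s(p.1, p.2) = z := by
    intro z
    rw [List.mem_toFinset, List.mem_map]
  rw [stripCount, wordCount_eq_sum (v := 2) (Set.finite_lt_nat _) (by simp) (by decide)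
    (by decide) ((choices nb M).map fun p => s(p.1, p.2)).toFinset,
    List.sum_toFinset _ (nodup_choices nb M), List.map_map, eliminate, List.map_map]
  · congr 1
    refine List.map_congr_left fun p hp => ?_
    obtain ⟨-, -, -, -, h1, h2⟩ := mem_choices.1 hp
    exact wordCount_shift j N h1 h2
  · intro p a b q hl
    have hn := hl.nodup
    have ha : s(2, a) ∈ edges (p ++ a :: 2 :: b :: q) := by
      rw [mem_edges_insert_iff, Sym2.eq_swap]; tauto
    have hb : s(2, b) ∈ edges (p ++ a :: 2 :: b :: q) := by
      rw [mem_edges_insert_iff]; tauto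
    have hab : a ≠ b := by simp [List.nodup_append] at hn ⊢; grind
    have ha2 : a ≠ 2 := by simp [List.nodup_append] at hn ⊢; grind
    have hb2 : b ≠ 2 := by simp [List.nodup_append] at hn ⊢; grind
    have hca := hl.mem_candidates (fun x h1 h2 h3 => (hnb x).2 ⟨h1, h2, h3⟩) ha
    have hcb := hl.mem_candidates (fun x h1 h2 h3 => (hnb x).2 ⟨h1, h2, h3⟩) hb
    have hmates : ∀ x, s(2, x) ∈ pairSet M → x = a ∨ x = b := fun x hx => by
      rcases not_three_neighbours hn (hl.req _ hx) ha hb with h | h | h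
      · exact Or.inl h
      · exact Or.inr h
      · exact absurd h hab
    have hM : s(a, b) ∉ pairSet M := fun h => by
      have := hl.req _ h
      rw [mem_edges_insert_iff] at this
      rcases this with h | h | h | h
      · have := mem_of_mem_edges h (Sym2.mem_mk_right a b)
        simp [List.nodup_append] at this hn; grind
      · rw [Sym2.eq_iff] at h; tauto
      · rw [Sym2.eq_iff] at h; tauto
      · have := mem_of_mem_edges h (Sym2.mem_mk_left a b)
        simp [List.nodup_append] at this hn; grind
    rw [hmem]
    rcases lt_or_gt_of_ne hab with h | h
    · exact ⟨(a, b), mem_choices.2 ⟨⟨hca, hcb⟩, h, hmates, hM, ha2, hb2⟩, rfl⟩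
    · refine ⟨(b, a), mem_choices.2 ⟨⟨hcb, hca⟩, h, fun x hx => (hmates x hx).symm, ?_, hb2, ha2⟩,
        Sym2.eq_swap⟩
      rwa [Sym2.eq_swap]
  · intro z hz
    obtain ⟨p, hp, rfl⟩ := (hmem z).1 hz
    exact (mem_choices.1 hp).2.2.2.1
  · intro z hz x hx
    obtain ⟨p, hp, rfl⟩ := (hmem z).1 hz
    exact Sym2.mem_iff.2 ((mem_choices.1 hp).2.2.1 x hx)
  · intro z hz x hx
    obtain ⟨p, hp, rfl⟩ := (hmem z).1 hz
    have hc : x ∈ candidates nb M := by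
      rcases Sym2.mem_iff.1 hx with rfl | rfl
      · exact (mem_choices.1 hp).1.1
      · exact (mem_choices.1 hp).1.2
    rcases mem_candidates.1 hc with h | ⟨h, -⟩ | ⟨rfl, -⟩
    · exact Or.inr h
    · exact Or.inl (mk_mem_stripPairs.2 ((hnb x).1 h).2.2)
    · exact Or.inl (mk_mem_stripPairs.2 (Or.inr (Or.inl rfl)))

/-- Without cells there is just the word `0, 1`. -/
theorem stripCount_zero (j : ℕ) (M : List (ℕ × ℕ)) :
    stripCount j 0 M = if ∀ p ∈ M, p = (0, 1) ∨ p = (1, 0) then 1 else 0 := by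
  have hword : ∀ l, IsWord 0 1 {x | x < 0 + 2} (stripPairs j) (pairSet M) l → l = [0, 1] := by
    intro l hl
    have hperm : l.Perm [0, 1] := by
      rw [List.perm_ext_iff_of_nodup hl.nodup (by decide)]
      intro x
      have : x ∈ l ↔ x < 2 := hl.mem x
      rw [this]
      simp only [List.mem_cons, List.not_mem_nil, or_false]
      omega
    obtain ⟨a, b, rfl⟩ := List.length_eq_two.1 hperm.length_eq
    have h0 : a = 0 := by simpa using hl.head
    have h1 : b = 1 := by simpa using hl.last
    rw [h0, h1]
  split_ifs with h
  · have : {l | IsWord 0 1 {x | x < 0 + 2} (stripPairs j) (pairSet M) l} = {[0, 1]} := by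
      refine Set.Subset.antisymm (fun l hl => hword l hl) ?_
      rintro _ rfl
      refine ⟨by decide, fun x => ?_, rfl, rfl, fun z hz => Or.inl ?_, ?_⟩
      · change x ∈ [0, 1] ↔ x < 2
        simp only [List.mem_cons, List.not_mem_nil, or_false]
        omega
      · rw [List.mem_singleton.1 hz]
        exact mk_mem_stripPairs.2 (Or.inr (Or.inl rfl))
      · rintro _ ⟨p, hp, rfl⟩
        rcases h p hp with rfl | rfl
        · exact List.mem_singleton.2 rfl
        · exact List.mem_singleton.2 Sym2.eq_swap
    rw [stripCount, wordCount, this, Set.ncard_singleton]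
  · rw [stripCount, wordCount, Set.ncard_eq_zero (finite_setOf_isWord (Set.finite_lt_nat _)),
      Set.eq_empty_iff_forall_notMem]
    intro l hl
    refine h fun p hp => ?_
    have hreq := hl.req _ ⟨p, hp, rfl⟩
    rw [hword l hl] at hreq
    rcases Sym2.eq_iff.1 (List.mem_singleton.1 hreq) with ⟨h1, h2⟩ | ⟨h1, h2⟩
    · exact Or.inl (Prod.ext h1 h2)
    · exact Or.inr (Prod.ext h1 h2)

/-- Elimination of a column of five cells, followed by another column or not. -/
def eliminateColumn (right : List ℕ) (M : List (ℕ × ℕ)) : List (List (ℕ × ℕ)) :=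
  -- The cell to be eliminated always has code `2`, the one below it `3`, and the one to its right
  -- `7`. The fifth cell is in the bottom row and has none below.
  [3 :: right, 3 :: right, 3 :: right, 3 :: right, right].foldl
    (fun L nb => L.flatMap (eliminate nb)) [M]

theorem sum_flatMap_eliminate (j N : ℕ) (nb : List ℕ)
    (hnb : ∀ x, x ∈ nb ↔ 2 < x ∧ x < N + 1 + 2 ∧ StripAdj j 2 x) (L : List (List (ℕ × ℕ))) :
    (L.map (stripCount j (N + 1))).sum =
      ((L.flatMap (eliminate nb)).map (stripCount (j + 1) N)).sum := by
  induction L with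
  | nil => rfl
  | cons M L ih =>
    rw [List.flatMap_cons, List.map_append, List.sum_append, ← stripCount_succ j N nb M hnb, ← ih,
      List.map_cons, List.sum_cons]

theorem stripCount_column (N : ℕ) (M : List (ℕ × ℕ)) :
    stripCount 0 (N + 10) M = ((eliminateColumn [7] M).map (stripCount 0 (N + 5))).sum := by
  have h : stripCount 0 (N + 10) M = ([M].map (stripCount 0 (N + 9 + 1))).sum := by simp
  -- Five eliminations move the starting row from `0` to `5`, which is row `0` of the next column.
  rw [h, eliminateColumn, ← funext (stripCount_add_five 0 (N + 5))]
  simp only [List.foldl_cons, List.foldl_nil]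
  rw [sum_flatMap_eliminate 0 (N + 9) [3, 7], sum_flatMap_eliminate 1 (N + 8) [3, 7],
    sum_flatMap_eliminate 2 (N + 7) [3, 7], sum_flatMap_eliminate 3 (N + 6) [3, 7],
    sum_flatMap_eliminate 4 (N + 5) [7]]
  all_goals
    intro x
    simp only [List.mem_cons, List.not_mem_nil, or_false, StripAdj]
    omega

theorem stripCount_last_column (M : List (ℕ × ℕ)) :
    stripCount 0 5 M = ((eliminateColumn [] M).map (stripCount 5 0)).sum := by
  have h : stripCount 0 5 M = ([M].map (stripCount 0 (4 + 1))).sum := by simp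
  rw [h, eliminateColumn]
  simp only [List.foldl_cons, List.foldl_nil]
  rw [sum_flatMap_eliminate 0 4 [3], sum_flatMap_eliminate 1 3 [3],
    sum_flatMap_eliminate 2 2 [3], sum_flatMap_eliminate 3 1 [3],
    sum_flatMap_eliminate 4 0 []]
  all_goals
    intro x
    simp only [List.mem_cons, List.not_mem_nil, or_false, false_iff, StripAdj]
    omega

end Elimination

/-! ### Greek key tours as words. -/

section Tours

/-- The code of a grid point in column order, from top to bottom, starting from `2`. -/
def cellCode {n : ℕ} (v : gridPoints 5 n) : ℕ := (5 * v.1.1 + (4 - v.1.2)).toNat + 2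

theorem cellCode_eq {n : ℕ} (v : gridPoints 5 n) :
    (cellCode v : ℤ) = 5 * v.1.1 + (4 - v.1.2) + 2 := by
  obtain ⟨v, h1, h2, h3, h4⟩ := v
  simp only [cellCode]
  push_cast at h4
  omega

theorem cellCode_injective (n : ℕ) : (cellCode : gridPoints 5 n → ℕ).Injective := by
  intro v w h
  have hv := cellCode_eq v
  have hw := cellCode_eq w
  obtain ⟨v, h1, h2, h3, h4⟩ := v
  obtain ⟨w, k1, k2, k3, k4⟩ := w
  push_cast at h4 k4
  refine Subtype.ext (Prod.ext ?_ ?_) <;> dsimp only at * <;> omega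

theorem range_cellCode (n : ℕ) :
    Set.range (cellCode : gridPoints 5 n → ℕ) = {x | 2 ≤ x ∧ x < 5 * n + 2} := by
  ext x
  constructor
  · rintro ⟨v, rfl⟩
    have hv := cellCode_eq v
    obtain ⟨v, h1, h2, h3, h4⟩ := v
    push_cast at h4
    change 2 ≤ cellCode _ ∧ cellCode _ < 5 * n + 2
    dsimp only at *; omega
  · rintro ⟨h1, h2⟩
    let v : gridPoints 5 n := ⟨(((x - 2) / 5 : ℕ), 4 - ((x - 2) % 5 : ℕ)), by
      refine ⟨?_, ?_, ?_, ?_⟩ <;> push_cast <;> omega⟩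
    refine ⟨v, ?_⟩
    have hv := cellCode_eq v
    dsimp only [v] at *; omega

theorem adj_iff_stripAdj {n : ℕ} (v w : gridPoints 5 n) :
    (gridGraph (gridPoints 5 n)).Adj v w ↔ StripAdj 0 (cellCode v) (cellCode w) := by
  have hv := cellCode_eq v
  have hw := cellCode_eq w
  have hunit : ∀ a b : ℤ, a ^ 2 + b ^ 2 = 1 ↔
      (a = 0 ∧ (b = 1 ∨ b = -1)) ∨ (b = 0 ∧ (a = 1 ∨ a = -1)) := by
    intro a b
    constructor
    · intro h
      have ha : a ≤ 1 := by nlinarith [sq_nonneg b]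
      have ha' : -1 ≤ a := by nlinarith [sq_nonneg b]
      have hb : b ≤ 1 := by nlinarith [sq_nonneg a]
      have hb' : -1 ≤ b := by nlinarith [sq_nonneg a]
      interval_cases a <;> interval_cases b <;> simp_all
    · rintro (⟨rfl, rfl | rfl⟩ | ⟨rfl, rfl | rfl⟩) <;> norm_num
  change (v.1.1 - w.1.1) ^ 2 + (v.1.2 - w.1.2) ^ 2 = 1 ↔ _
  rw [hunit]
  obtain ⟨v, h1, h2, h3, h4⟩ := v
  obtain ⟨w, k1, k2, k3, k4⟩ := w
  push_cast at h4 k4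
  unfold StripAdj
  dsimp only at *
  omega

/-- The word of a tour. -/
def tourWord {n : ℕ} (w : List (gridPoints 5 n)) : List ℕ := 0 :: (w.map cellCode ++ [1])

theorem tourWord_injective (n : ℕ) : (tourWord : List (gridPoints 5 n) → List ℕ).Injective := by
  intro w w' h
  unfold tourWord at h
  exact (cellCode_injective n).list_map (List.append_cancel_right (List.cons.inj h).2)

theorem edges_tourWord {n : ℕ} {w : List (gridPoints 5 n)} {v : gridPoints 5 n}
    (hv : w.head? = some v) :
    ∀ z, z ∈ edges (tourWord w) ↔ z = s(0, cellCode v) ∨ z ∈ edges (w.map cellCode) ∨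
      ∃ u, w.getLast? = some u ∧ z = s(cellCode u, 1) := by
  intro z
  have h1 : edges (tourWord w) = s(0, cellCode v) :: edges (w.map cellCode ++ [1]) := by
    cases w with
    | nil => simp at hv
    | cons x w =>
      simp only [List.head?_cons, Option.some.injEq] at hv
      subst hv; rfl
  obtain ⟨w', u, rfl⟩ : ∃ w' u, w = w' ++ [u] := by
    rcases List.eq_nil_or_concat w with rfl | ⟨w', u, h⟩
    · simp at hv
    · exact ⟨w', u, by simpa using h⟩
  have h2 : (w' ++ [u]).map cellCode ++ [1] = w'.map cellCode ++ cellCode u :: 1 :: [] := by simp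
  rw [h1, h2, edges_append_cons_cons]
  simp [edges]

/-- The required pair `(0, 2)` forces the start, since `2` codes the upper-left corner. The final
pair with `1` is always allowed, and trapping is automatic once every vertex is visited. Positivity
of `n` excludes the empty tour. -/
theorem isGreekKeyTour_iff {n : ℕ} (hn : 0 < n) (w : List (gridPoints 5 n)) :
    IsGreekKeyTour 5 n w ↔
      IsWord 0 1 {x | x < 5 * n + 2} (stripPairs 0) (pairSet [(0, 2)]) (tourWord w) := by
  have hcode : ∀ v : gridPoints 5 n, 2 ≤ cellCode v ∧ cellCode v < 5 * n + 2 := fun v => by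
    have : cellCode v ∈ Set.range (cellCode : gridPoints 5 n → ℕ) := ⟨v, rfl⟩
    rwa [range_cellCode] at this
  have hmem : (∀ v, v ∈ w) ↔ ∀ x, x ∈ tourWord w ↔ x ∈ {x | x < 5 * n + 2} := by
    constructor
    · intro h x
      simp only [tourWord, List.mem_cons, List.mem_append, List.mem_map, List.not_mem_nil, or_false]
      constructor
      · rintro (rfl | ⟨v, -, rfl⟩ | rfl)
        · change 0 < 5 * n + 2; omega
        · exact (hcode v).2
        · change 1 < 5 * n + 2; omega
      · intro hx
        have hx : x < 5 * n + 2 := hx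
        by_cases h2 : 2 ≤ x
        · have : x ∈ Set.range (cellCode : gridPoints 5 n → ℕ) := by
            rw [range_cellCode]; exact ⟨h2, hx⟩
          obtain ⟨v, rfl⟩ := this
          exact Or.inr (Or.inl ⟨v, h v, rfl⟩)
        · omega
    · intro h v
      have := (h (cellCode v)).2 (hcode v).2
      simp only [tourWord, List.mem_cons, List.mem_append, List.not_mem_nil, or_false,
        List.mem_map_of_injective (cellCode_injective n)] at this
      have := (hcode v).1
      grind
  have hnodup : w.Nodup ↔ (tourWord w).Nodup := by
    rw [tourWord, List.nodup_cons, List.nodup_append, List.nodup_map_iff (cellCode_injective n)]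
    constructor
    · intro h
      refine ⟨?_, h, by simp, ?_⟩
      · intro h0
        simp only [List.mem_append, List.mem_map, List.mem_singleton] at h0
        rcases h0 with ⟨v, -, hv⟩ | h0
        · have := (hcode v).1; omega
        · omega
      · intro x hx y hy
        obtain ⟨v, -, rfl⟩ := List.mem_map.1 hx
        have := (hcode v).1
        rw [List.mem_singleton] at hy
        omega
    · exact fun h => h.2.1
  have hchain : w.IsChain (gridGraph (gridPoints 5 n)).Adj ↔
      ∀ z ∈ edges (w.map cellCode), z ∈ stripPairs 0 := by
    rw [← isChain_iff_forall_edges (r := StripAdj 0) fun x y => mk_mem_stripPairs.symm,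
      List.isChain_map]
    exact ⟨fun h => h.imp fun _ _ => (adj_iff_stripAdj _ _).1,
      fun h => h.imp fun _ _ => (adj_iff_stripAdj _ _).2⟩
  have hstart : ∀ v : gridPoints 5 n, (v : ℤ × ℤ) = (0, ((5 : ℕ) : ℤ) - 1) ↔ cellCode v = 2 := by
    intro v
    have hv := cellCode_eq v
    obtain ⟨v, h1, h2, h3, h4⟩ := v
    push_cast at h4
    rw [Prod.ext_iff]
    push_cast
    dsimp only at *
    omega
  cases hw : w.head? with
  | none =>
    rw [List.head?_eq_none_iff] at hw
    subst hw
    constructor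
    · intro h
      have := h.2.2 ⟨(0, 0), by refine ⟨?_, ?_, ?_, ?_⟩ <;> push_cast <;> omega⟩
      simp at this
    · intro h
      have := (h.mem 2).2 (by change 2 < 5 * n + 2; omega)
      simp [tourWord] at this
  | some v =>
    have hedges := edges_tourWord hw
    have hstart' := hstart v
    unfold IsGreekKeyTour IsGSAW
    rw [hw]
    constructor
    · rintro ⟨⟨h1, h2, -⟩, h3, h4⟩
      have hv : cellCode v = 2 := hstart'.1 (h3 v rfl)
      refine ⟨hnodup.1 h2, hmem.1 h4, rfl, List.getLast?_concat (l := 0 :: w.map cellCode),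
        fun z hz => ?_, fun z hz => ?_⟩
      · rcases (hedges z).1 hz with rfl | hz | ⟨u, -, rfl⟩
        · exact Or.inr ⟨(0, 2), by simp, by rw [hv]⟩
        · exact Or.inl (hchain.1 h1 z hz)
        · exact Or.inl (mk_mem_stripPairs.2 (Or.inr (Or.inl rfl)))
      · obtain ⟨p, hp, rfl⟩ := hz
        rw [List.mem_singleton.1 hp, hedges, hv]
        exact Or.inl rfl
    · rintro ⟨h1, h2, -, -, h5, h6⟩
      have hmem' := hmem.2 h2
      refine ⟨⟨hchain.2 fun z hz => ?_, hnodup.2 h1, fun _ _ u _ => hmem' u⟩, ?_, hmem'⟩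
      · refine (h5 z ((hedges z).2 (Or.inr (Or.inl hz)))).resolve_right ?_
        -- The only required pair contains `0`, which codes no cell, so every step between cells is
        -- a genuine adjacency.
        rintro ⟨p, hp, rfl⟩
        rw [List.mem_singleton.1 hp] at hz
        obtain ⟨u, -, hu⟩ := List.mem_map.1 (mem_of_mem_edges hz (Sym2.mem_mk_left _ _))
        have := (hcode u).1
        dsimp only at hu
        omega
      · rintro _ ⟨rfl⟩
        refine hstart'.2 ?_
        have := (hedges _).1 (h6 s(0, 2) ⟨(0, 2), by simp, rfl⟩)
        rcases this with h | h | ⟨u, -, h⟩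
        · rcases Sym2.eq_iff.1 h with h | h <;> omega
        · obtain ⟨u, -, hu⟩ := List.mem_map.1 (mem_of_mem_edges h (Sym2.mem_mk_left _ _))
          have := (hcode u).1
          omega
        · rcases Sym2.eq_iff.1 h with h | h <;> omega

theorem greekKeyCount_eq_stripCount {n : ℕ} (hn : 0 < n) :
    greekKeyCount 5 n = stripCount 0 (5 * n) [(0, 2)] := by
  rw [greekKeyCount, stripCount, wordCount, ← Set.ncard_image_of_injective _ (tourWord_injective n)]
  congr 1
  ext l
  constructor
  · rintro ⟨w, hw, rfl⟩
    exact (isGreekKeyTour_iff hn w).1 hw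
  · intro hl
    obtain ⟨l', rfl⟩ := List.getLast?_eq_some_iff.1 hl.last
    cases l' with
    | nil => exact absurd hl.head (by simp)
    | cons x l' =>
      obtain rfl : x = 0 := by simpa using hl.head
      have hn := hl.nodup
      -- With `0` in front and `1` at the end, absence of repetitions leaves only cell codes in
      -- between.
      have hl' : l' ∈ Set.range (List.map (cellCode : gridPoints 5 n → ℕ)) := by
        rw [Set.range_list_map, range_cellCode]
        intro x hx
        have hx' : x < 5 * n + 2 := (hl.mem x).1 (by simp [hx])
        refine ⟨?_, hx'⟩
        simp [List.nodup_append] at hn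
        grind
      obtain ⟨w, rfl⟩ := hl'
      exact ⟨w, (isGreekKeyTour_iff ‹0 < n› w).2 hl, rfl⟩

theorem greekKeyCount_zero : greekKeyCount 5 0 = 1 := by
  have hempty : IsEmpty (gridPoints 5 0) := ⟨fun ⟨v, h1, h2, _⟩ => by push_cast at h2; omega⟩
  have : {w : List (gridPoints 5 0) | IsGreekKeyTour 5 0 w} = {[]} := by
    ext w
    constructor
    · exact fun _ => List.eq_nil_iff_forall_not_mem.2 fun v => (hempty.false v).elim
    · rintro rfl
      exact ⟨⟨List.isChain_nil, List.nodup_nil, by simp⟩, by simp, fun v => (hempty.false v).elim⟩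
  rw [greekKeyCount, this, Set.ncard_singleton]

end Tours

/-! ### The transfer matrix on classes of states, and the recurrence. -/

section Transfer

/-- The states reachable at the left end of a column, each with its class: states of one class have
the same number of completions, and states of class `0` have none. -/
def stateTable : List (List (ℕ × ℕ) × ℕ) :=
  [([(0, 1), (3, 6)], 0), ([(0, 1), (3, 4), (5, 6)], 0), ([(0, 1), (4, 6)], 0),
   ([(0, 1), (5, 6)], 0), ([(0, 1)], 0), ([(0, 1), (2, 4)], 0), ([(0, 1), (2, 6), (4, 5)], 0),
   ([(0, 1), (2, 6)], 0), ([(0, 1), (2, 4), (5, 6)], 0), ([(0, 1), (2, 5)], 0),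
   ([(0, 1), (2, 3), (5, 6)], 0), ([(0, 1), (2, 3), (4, 5)], 0), ([(0, 1), (2, 3), (4, 6)], 0),
   ([(0, 1), (2, 3)], 0), ([(0, 1), (4, 5)], 0), ([(0, 1), (3, 4)], 0),
   ([(0, 1), (3, 6), (4, 5)], 0), ([(0, 1), (2, 6), (3, 5)], 0), ([(0, 1), (2, 5), (3, 4)], 0),
   ([(0, 1), (2, 6), (3, 4)], 0), ([(0, 2)], 1), ([(0, 6)], 1), ([(0, 5), (1, 6)], 2),
   ([(0, 2), (1, 3), (5, 6)], 2), ([(0, 2), (1, 3)], 2), ([(0, 6), (1, 5)], 2),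
   ([(0, 3), (1, 2)], 2), ([(0, 6), (1, 5), (2, 3)], 2), ([(0, 5), (1, 6), (2, 3)], 2),
   ([(0, 3), (1, 2), (5, 6)], 2), ([(0, 4), (1, 6)], 3), ([(0, 2), (1, 4), (5, 6)], 3),
   ([(0, 2), (1, 3), (4, 6)], 3), ([(0, 4), (1, 2)], 3), ([(0, 6), (1, 5), (2, 4)], 3),
   ([(0, 6), (1, 4), (2, 3)], 3), ([(0, 5), (1, 6), (2, 4)], 3), ([(0, 4), (1, 6), (2, 3)], 3),
   ([(0, 4), (1, 2), (5, 6)], 3), ([(0, 2), (1, 4)], 3), ([(0, 6), (1, 4)], 3),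
   ([(0, 3), (1, 2), (4, 6)], 3), ([(0, 4), (1, 5)], 4), ([(0, 3), (1, 4), (5, 6)], 4),
   ([(0, 3), (1, 4)], 4), ([(0, 5), (1, 4)], 4), ([(0, 4), (1, 3)], 4),
   ([(0, 5), (1, 4), (2, 3)], 4), ([(0, 4), (1, 5), (2, 3)], 4), ([(0, 4), (1, 3), (5, 6)], 4),
   ([(0, 3), (1, 2), (4, 5)], 4), ([(0, 2), (1, 3), (4, 5)], 4), ([(0, 6), (1, 5), (3, 4)], 4),
   ([(0, 5), (1, 6), (3, 4)], 4), ([(0, 4), (5, 6)], 5), ([(0, 4), (2, 3)], 5),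
   ([(0, 3), (1, 6)], 6), ([(0, 3), (1, 6), (4, 5)], 6), ([(0, 2), (1, 5), (3, 4)], 6),
   ([(0, 6), (1, 3), (4, 5)], 6), ([(0, 5), (1, 2), (3, 4)], 6), ([(0, 5), (1, 2)], 6),
   ([(0, 2), (1, 5)], 6), ([(0, 6), (1, 3)], 6), ([(0, 3), (4, 6)], 7), ([(0, 5), (2, 4)], 7),
   ([(0, 2), (1, 6)], 8), ([(0, 6), (1, 2)], 8), ([(0, 2), (3, 6)], 9), ([(0, 6), (2, 5)], 9),
   ([(0, 2), (1, 6), (3, 5)], 10), ([(0, 6), (1, 2), (3, 5)], 10),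
   ([(0, 2), (1, 6), (3, 4)], 11), ([(0, 6), (1, 2), (4, 5)], 11),
   ([(0, 2), (1, 6), (4, 5)], 11), ([(0, 6), (1, 2), (3, 4)], 11),
   ([(0, 2), (3, 4), (5, 6)], 12), ([(0, 6), (2, 3), (4, 5)], 12), ([(0, 2), (5, 6)], 13),
   ([(0, 6), (2, 3)], 13), ([(0, 4), (2, 3), (5, 6)], 14), ([(0, 2), (1, 5), (4, 6)], 15),
   ([(0, 2), (1, 4), (3, 6)], 15), ([(0, 6), (1, 4), (2, 5)], 15),
   ([(0, 6), (1, 3), (2, 4)], 15), ([(0, 2), (4, 5)], 16), ([(0, 6), (3, 4)], 16),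
   ([(0, 4)], 17), ([(0, 6), (4, 5)], 18), ([(0, 2), (3, 4)], 18),
   ([(0, 2), (1, 5), (3, 6)], 19), ([(0, 6), (1, 3), (2, 5)], 19),
   ([(0, 2), (1, 4), (3, 5)], 20), ([(0, 6), (1, 4), (3, 5)], 20),
   ([(0, 3), (1, 5), (4, 6)], 20), ([(0, 5), (1, 3), (2, 4)], 20),
   ([(0, 2), (3, 6), (4, 5)], 21), ([(0, 6), (2, 5), (3, 4)], 21)]

/-- The classes, other than `0`, reached from each class by the elimination of a column. -/
def classRows : List (List ℕ) :=
  [[], [1, 2, 2, 2, 3, 3, 3, 4, 4, 4, 5, 6, 6, 6, 7, 8, 9, 10, 11, 12], [3, 3, 8], [2, 4, 6],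
   [3, 8], [2, 3, 3, 4, 4, 6, 6, 8, 8, 13, 13, 14], [3, 11], [2, 3, 4, 6, 6, 6, 8, 13, 15, 16],
   [2, 2, 4, 4, 6, 6, 10],
   [2, 2, 3, 3, 3, 4, 4, 6, 6, 8, 11, 13, 15, 15, 16, 17, 18, 18, 19, 20, 21], [3, 3, 11, 11],
   [2, 2, 4, 6, 10], [1, 2, 2, 3, 3, 4, 5, 6, 8, 9, 11, 12],
   [1, 2, 2, 3, 3, 3, 4, 4, 4, 5, 6, 6, 7, 8, 9, 11, 12], [3, 3, 4, 4, 6, 6, 8, 8, 13, 13, 14],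
   [2, 2, 4, 6, 19, 20], [1, 2, 2, 3, 4, 6, 6, 7, 8, 9, 10],
   [2, 2, 3, 3, 4, 4, 6, 6, 8, 8, 13, 13, 14], [1, 2, 2, 2, 3, 3, 4, 5, 6, 8, 9, 10, 11, 12],
   [3, 3, 8, 15, 15], [3, 8, 15], [2, 2, 3, 3, 4, 6, 8, 11, 13, 15, 17, 18, 18, 19, 21]]

/-- The numbers of completions of each class for the first widths. -/
def classValues : List (List ℕ) :=
  [[0, 1, 0, 0, 0, 0, 0, 0, 1, 1, 0, 1, 1, 1, 0, 1, 1, 0, 1, 0, 0, 1],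
   [0, 5, 1, 0, 1, 4, 1, 4, 0, 9, 2, 0, 5, 5, 4, 0, 3, 4, 5, 3, 2, 7],
   [0, 38, 0, 3, 0, 19, 0, 13, 8, 40, 0, 6, 27, 34, 18, 9, 25, 20, 30, 0, 0, 33],
   [0, 160, 14, 0, 11, 108, 9, 79, 0, 213, 18, 0, 144, 160, 108, 0, 102, 108, 144, 32, 20, 176],
   [0, 824, 0, 34, 0, 482, 0, 314, 86, 954, 0, 66, 673, 783, 468, 100, 527, 496, 705, 0, 0, 812],
   [0, 3501, 154, 0, 120, 2274, 100, 1530, 0, 4482, 200, 0, 3153, 3501, 2274, 0, 2212, 2274, 3153,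
     354, 220, 3821],
   [0, 16262, 0, 374, 0, 9870, 0, 6287, 948, 19436, 0, 728, 13938, 15808, 9716, 1102, 10341, 10024,
     14292, 0, 0, 16784],
   [0, 68591, 1696, 0, 1322, 43976, 1102, 28573, 0, 86543, 2204, 0, 61930, 68591, 43976, 0, 43307,
     43976, 61930, 3900, 2424, 74726],
   [0, 304177, 0, 4120, 0, 187702, 0, 118222, 10444, 369024, 0, 8020, 266856, 299175, 186006,
     12140, 192829, 189398, 270756, 0, 0, 320869],
   [0, 1276805, 18684, 0, 14564, 813484, 12140, 518708, 0, 1598887, 24280, 0, 1154463, 1276805,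
     813484, 0, 805987, 813484, 1154463, 42964, 26704, 1389798],
   [0, 5522791, 0, 45388, 0, 3439186, 0, 2152460, 115056, 6755444, 0, 88352, 4907711, 5467687,
     3420502, 133740, 3494892, 3457870, 4950675, 0, 0, 5896049],
   [0, 23117164, 205832, 0, 160444, 14676764, 133740, 9256763, 0, 28824900, 267480, 0, 20919316,
     23117164, 14676764, 0, 14591139, 14676764, 20919316, 473312, 294184, 25150880],
   [0, 98562435, 0, 500016, 0, 61705292, 0, 38475799, 1267512, 121142107, 0, 973328, 88243992,
     97955383, 61499460, 1473344, 62305895, 61911124, 88717304, 0, 0, 105962600],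
   [0, 411870513, 2267544, 0, 1767528, 260945282, 1473344, 163502150, 0, 512257186, 2946688, 0,
     372894698, 411870513, 260945282, 0, 259947869, 260945282, 372894698, 5214232, 3240872,
     447977931],
   [0, 1740941765, 0, 5508416, 0, 1093435596, 0, 680273486, 13963520, 2146002927, 0, 10722648,
     1565743639, 1734254189, 1091168052, 16231064, 1099825841, 1095703140, 1570957871, 0, 0,
     1879573314]]

/-- The class of a state, if it is reachable. -/
def stateClass (M : List (ℕ × ℕ)) : Option ℕ := List.lookup M stateTable

/-- The transfer from one width to the next. -/
def transfer (b : List ℕ) : List ℕ := classRows.map fun r => (r.map (b.getD · 0)).sum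

/-- The number of completions of each class on `n + 1` columns. -/
def completions : ℕ → List ℕ
  | 0 => classValues.getD 0 []
  | n + 1 => transfer (completions n)

theorem completions_succ_getD (n c : ℕ) : (completions (n + 1)).getD c 0 =
    ((classRows.getD c []).map ((completions n).getD · 0)).sum := by
  exact List.getD_map classRows [] fun r => (r.map ((completions n).getD · 0)).sum

theorem completions_getD_zero (n : ℕ) : (completions n).getD 0 0 = 0 := by
  cases n with
  | zero => rfl
  | succ n => rw [completions_succ_getD]; rfl

theorem completions_eq {n : ℕ} (hn : n < 15) : completions n = classValues.getD n [] := by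
  have h : ∀ m < 14, transfer (classValues.getD m []) = classValues.getD (m + 1) [] := by
    decide +kernel
  induction n with
  | zero => rfl
  | succ n ih => rw [completions, ih (by omega), h n (by omega)]

theorem stateTable_last_column : ∀ q ∈ stateTable,
    ((eliminateColumn [] q.1).map fun M =>
      if ∀ p ∈ M, p = (0, 1) ∨ p = (1, 0) then 1 else 0).sum = (completions 0).getD q.2 0 := by
  decide +kernel

/-- The partition into classes is compatible with elimination: up to dead states, the multiset of
classes reached depends only on the class. An outcome missing from the table would survive the
filter as `none`, so this also shows that the table is closed under elimination. -/
theorem stateTable_column : ∀ q ∈ stateTable,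
    (((eliminateColumn [7] q.1).map stateClass).filter (· ≠ some 0)).Perm
      ((classRows.getD q.2 []).map some) := by
  decide +kernel

theorem sum_filter_of_eq_zero {β : Type*} (p : β → Prop) [DecidablePred p] (g : β → ℕ)
    (hg : ∀ x, ¬ p x → g x = 0) (l : List β) : ((l.filter p).map g).sum = (l.map g).sum := by
  induction l with
  | nil => rfl
  | cons x l ih =>
    by_cases hx : p x
    · simp [hx, ih]
    · simp [hx, ih, hg x hx]

theorem mem_of_lookup_eq_some {β γ : Type*} [BEq β] [LawfulBEq β] {l : List (β × γ)} {x : β} {y : γ}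
    (h : List.lookup x l = some y) : (x, y) ∈ l := by
  obtain ⟨l₁, l₂, rfl, -⟩ := List.lookup_eq_some_iff.1 h
  simp

/-- The induction treats all states of the table at once; this is what proves that states of one
class have equally many completions and that class `0` has none. -/
theorem stripCount_eq_completions (n : ℕ) : ∀ q ∈ stateTable,
    stripCount 0 (5 * n + 5) q.1 = (completions n).getD q.2 0 := by
  induction n with
  | zero =>
    intro q hq
    rw [← stateTable_last_column q hq, mul_zero, zero_add, stripCount_last_column]
    exact congrArg List.sum (List.map_congr_left fun M _ => stripCount_zero 5 M)
  | succ n ih =>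
    intro q hq
    have hperm := stateTable_column q hq
    -- The default for `none` is immaterial, since `hperm` excludes `none` among the outcomes.
    let g : Option ℕ → ℕ := fun o => (completions n).getD (o.getD 0) 0
    have hg : ∀ M ∈ eliminateColumn [7] q.1, stripCount 0 (5 * n + 5) M = g (stateClass M) := by
      intro M hM
      cases h : stateClass M with
      | none =>
        have : none ∈ ((eliminateColumn [7] q.1).map stateClass).filter (· ≠ some 0) :=
          List.mem_filter.2 ⟨h ▸ List.mem_map_of_mem hM, by simp⟩
        simpa using hperm.mem_iff.1 this
      | some c => exact ih (M, c) (mem_of_lookup_eq_some h)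
    rw [show 5 * (n + 1) + 5 = 5 * n + 10 by ring, stripCount_column, List.map_congr_left hg,
      completions_succ_getD, show (fun M => g (stateClass M)) = g ∘ stateClass from rfl,
      ← List.map_map, ← sum_filter_of_eq_zero (· ≠ some 0) g, (hperm.map g).sum_eq, List.map_map]
    · rfl
    · intro o ho
      rw [not_not.1 ho]
      exact completions_getD_zero n

theorem greekKeyCount_succ (n : ℕ) : greekKeyCount 5 (n + 1) = (completions n).getD 1 0 := by
  rw [greekKeyCount_eq_stripCount n.succ_pos, show 5 * (n + 1) = 5 * n + 5 by ring]
  exact stripCount_eq_completions n ([(0, 2)], 1) (by decide +kernel)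

/-- The defect of the recurrence. -/
def recurrenceDefect (a : ℕ → ℤ) (n : ℕ) : ℤ :=
  a (n + 13) - 4 * a (n + 12) - 14 * a (n + 11) + 54 * a (n + 10) + 33 * a (n + 9) - 117 * a (n + 8)
    - 2 * a (n + 7) + 84 * a (n + 6) + 6 * a (n + 5) - 9 * a (n + 4) + 14 * a (n + 2) + 2 * a n

/-- The defect is linear in the sequence, and each class at the next width is a sum of classes at
the present one. Vanishing for all classes at one index therefore passes to the next, so only the
initial index needs computation. It is `1` rather than `0`: for class `1` the earlier defect is the
coefficient `-3` of `X ^ 14` in the numerator. -/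
theorem recurrenceDefect_completions (n c : ℕ) :
    recurrenceDefect (fun m => ((completions m).getD c 0 : ℕ)) (n + 1) = 0 := by
  induction n generalizing c with
  | zero =>
    simp only [recurrenceDefect]
    rw [completions_eq (by omega), completions_eq (by omega), completions_eq (by omega),
      completions_eq (by omega), completions_eq (by omega), completions_eq (by omega),
      completions_eq (by omega), completions_eq (by omega), completions_eq (by omega),
      completions_eq (by omega), completions_eq (by omega), completions_eq (by omega)]
    by_cases hc : c < 22
    · revert c
      decide +kernel
    -- Beyond the 22 classes every lookup returns the default `0`.
    · have h : ∀ m < 15, (classValues.getD m []).getD c 0 = 0 := by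
        have hlen : ∀ m < 15, (classValues.getD m []).length ≤ 22 := by decide +kernel
        exact fun m hm => List.getD_eq_default _ _ ((hlen m hm).trans (not_lt.1 hc))
      simp only [zero_add, Nat.reduceAdd, h, Nat.reduceLT]
      norm_num
  | succ n ih =>
    have key : ∀ r : List ℕ,
        recurrenceDefect (fun m => ((r.map ((completions m).getD · 0)).sum : ℕ)) (n + 1) = 0 := by
      intro r
      induction r with
      | nil => simp [recurrenceDefect]
      | cons d r ihr =>
        have hd := ih d
        simp only [recurrenceDefect, List.map_cons, List.sum_cons, Nat.cast_add] at hd ihr ⊢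
        linarith
    rw [← key (classRows.getD c [])]
    simp only [recurrenceDefect, ← completions_succ_getD, add_assoc, Nat.reduceAdd]

/-- `completions m` belongs to width `m + 1`, which accounts for the shift of the index from `n + 1`
to `n + 2`. -/
theorem recurrenceDefect_greekKeyCount (n : ℕ) :
    recurrenceDefect (fun m => greekKeyCount 5 m) (n + 2) = 0 := by
  rw [← recurrenceDefect_completions n 1]
  simp only [recurrenceDefect, ← greekKeyCount_succ, add_assoc, Nat.reduceAdd]

theorem greekKeyCount_of_lt {n : ℕ} (hn : n < 15) :
    greekKeyCount 5 (n + 1) = (classValues.getD n []).getD 1 0 := by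
  rw [greekKeyCount_succ, completions_eq hn]

end Transfer

/-! ### From the recurrence to the rational generating function. -/

section GeneratingFunction

theorem greekKeyCount_rec {n : ℕ} (hn : 15 ≤ n) :
    (greekKeyCount 5 n : ℤ) =
      4 * greekKeyCount 5 (n - 1) + 14 * greekKeyCount 5 (n - 2)
      - 54 * greekKeyCount 5 (n - 3) - 33 * greekKeyCount 5 (n - 4)
      + 117 * greekKeyCount 5 (n - 5) + 2 * greekKeyCount 5 (n - 6)
      - 84 * greekKeyCount 5 (n - 7) - 6 * greekKeyCount 5 (n - 8)
      + 9 * greekKeyCount 5 (n - 9) - 14 * greekKeyCount 5 (n - 11)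
      - 2 * greekKeyCount 5 (n - 13) := by
  obtain ⟨m, rfl⟩ := Nat.exists_eq_add_of_le' hn
  have h := recurrenceDefect_greekKeyCount m
  simp only [recurrenceDefect, add_assoc, Nat.reduceAdd] at h
  simp only [Nat.add_sub_assoc, Nat.reduceLeDiff, Nat.reduceSub]
  linarith

theorem greekKeyCount_values {n : ℕ} (hn : n < 15) : greekKeyCount 5 n =
    [1, 1, 5, 38, 160, 824, 3501, 16262, 68591, 304177, 1276805, 5522791, 23117164, 98562435,
      411870513].getD n 0 := by
  cases n with
  | zero => exact greekKeyCount_zero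
  | succ m =>
    rw [greekKeyCount_of_lt (by omega)]
    have hm : m < 14 := by omega
    clear hn
    revert m
    decide +kernel

open PowerSeries in
theorem coeff_greekKeySeries_mul_X_pow (k n : ℕ) :
    coeff n (greekKeySeries 5 * X ^ k) = if k ≤ n then (greekKeyCount 5 (n - k) : ℚ) else 0 := by
  rw [coeff_mul_X_pow']
  simp [greekKeySeries]

open PowerSeries in
-- The expanded denominator has the coefficients of the recurrence, so all coefficients of the
-- product from degree 15 on vanish; the fifteen lower ones are computed from the known values.
theorem greekKeySeries_mul_denominator :
    greekKeySeries 5 * ((1 + X) * (1 - 11 * X ^ 2 - 2 * X ^ 6) *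
      (1 - 5 * X + 2 * X ^ 2 + 8 * X ^ 3 - 8 * X ^ 4 + X ^ 5 - X ^ 6)) =
    1 - 3 * X - 13 * X ^ 2 + 58 * X ^ 3 + 25 * X ^ 4 - 162 * X ^ 5 + 63 * X ^ 6 + 113 * X ^ 7
      - 61 * X ^ 8 + 12 * X ^ 9 - 11 * X ^ 10 + 25 * X ^ 11 - 17 * X ^ 12 + 5 * X ^ 13
      - 3 * X ^ 14 := by
  set G := greekKeySeries 5 with hG
  -- Each term is put in the form constant times `G * X ^ k`, even for `k = 0`, so that one
  -- coefficient formula serves all of them. The powers 10 and 12 cancel in the denominator.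
  have hexpand : G * ((1 + X) * (1 - 11 * X ^ 2 - 2 * X ^ 6) *
      (1 - 5 * X + 2 * X ^ 2 + 8 * X ^ 3 - 8 * X ^ 4 + X ^ 5 - X ^ 6)) =
      G * X ^ 0 - C 4 * (G * X ^ 1) - C 14 * (G * X ^ 2) + C 54 * (G * X ^ 3) + C 33 * (G * X ^ 4)
      - C 117 * (G * X ^ 5) - C 2 * (G * X ^ 6) + C 84 * (G * X ^ 7) + C 6 * (G * X ^ 8)
      - C 9 * (G * X ^ 9) + C 14 * (G * X ^ 11) + C 2 * (G * X ^ 13) := by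
    simp only [map_ofNat]
    ring
  have hnum : (1 - 3 * X - 13 * X ^ 2 + 58 * X ^ 3 + 25 * X ^ 4 - 162 * X ^ 5 + 63 * X ^ 6
      + 113 * X ^ 7 - 61 * X ^ 8 + 12 * X ^ 9 - 11 * X ^ 10 + 25 * X ^ 11 - 17 * X ^ 12 + 5 * X ^ 13
      - 3 * X ^ 14 : ℚ⟦X⟧) =
      X ^ 0 - C 3 * X ^ 1 - C 13 * X ^ 2 + C 58 * X ^ 3 + C 25 * X ^ 4 - C 162 * X ^ 5 + C 63 * X ^ 6
      + C 113 * X ^ 7 - C 61 * X ^ 8 + C 12 * X ^ 9 - C 11 * X ^ 10 + C 25 * X ^ 11 - C 17 * X ^ 12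
      + C 5 * X ^ 13 - C 3 * X ^ 14 := by
    simp only [map_ofNat]
    ring
  rw [hexpand, hnum]
  ext n
  simp only [map_add, map_sub, coeff_C_mul, hG, coeff_greekKeySeries_mul_X_pow, coeff_X_pow]
  by_cases hn : 15 ≤ n
  · have h := congrArg (Int.cast : ℤ → ℚ) (greekKeyCount_rec hn)
    push_cast at h
    have hle : ∀ k ≤ 15, k ≤ n := fun k hk => hk.trans hn
    have hne : ∀ k < 15, n ≠ k := fun k hk => (hk.trans_le hn).ne'
    simp only [hle, hne, Nat.reduceLeDiff, Nat.reduceLT, if_true, if_false, Nat.sub_zero, h]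
    ring
  · interval_cases n <;> norm_num [greekKeyCount_values]

end GeneratingFunction

theorem mainTheorem8 :
    greekKeySeries 5 =
      (1 - 3 * PowerSeries.X - 13 * PowerSeries.X ^ 2 + 58 * PowerSeries.X ^ 3
        + 25 * PowerSeries.X ^ 4 - 162 * PowerSeries.X ^ 5 + 63 * PowerSeries.X ^ 6
        + 113 * PowerSeries.X ^ 7 - 61 * PowerSeries.X ^ 8 + 12 * PowerSeries.X ^ 9
        - 11 * PowerSeries.X ^ 10 + 25 * PowerSeries.X ^ 11 - 17 * PowerSeries.X ^ 12
        + 5 * PowerSeries.X ^ 13 - 3 * PowerSeries.X ^ 14) *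
      ((1 + PowerSeries.X) * (1 - 11 * PowerSeries.X ^ 2 - 2 * PowerSeries.X ^ 6) *
        (1 - 5 * PowerSeries.X + 2 * PowerSeries.X ^ 2 + 8 * PowerSeries.X ^ 3
          - 8 * PowerSeries.X ^ 4 + PowerSeries.X ^ 5 - PowerSeries.X ^ 6))⁻¹ ∧
    (greekKeyCount 5 0 = 1 ∧ greekKeyCount 5 1 = 1 ∧ greekKeyCount 5 2 = 5 ∧
      greekKeyCount 5 3 = 38 ∧ greekKeyCount 5 4 = 160 ∧ greekKeyCount 5 5 = 824) ∧
    ∀ n : ℕ, 15 ≤ n →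
      (greekKeyCount 5 n : ℤ) =
        4 * greekKeyCount 5 (n - 1) + 14 * greekKeyCount 5 (n - 2)
        - 54 * greekKeyCount 5 (n - 3) - 33 * greekKeyCount 5 (n - 4)
        + 117 * greekKeyCount 5 (n - 5) + 2 * greekKeyCount 5 (n - 6)
        - 84 * greekKeyCount 5 (n - 7) - 6 * greekKeyCount 5 (n - 8)
        + 9 * greekKeyCount 5 (n - 9) - 14 * greekKeyCount 5 (n - 11)
        - 2 * greekKeyCount 5 (n - 13) := by
  refine ⟨?_, ⟨greekKeyCount_zero, greekKeyCount_of_lt (by norm_num),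
    greekKeyCount_of_lt (by norm_num), greekKeyCount_of_lt (by norm_num),
    greekKeyCount_of_lt (by norm_num), greekKeyCount_of_lt (by norm_num)⟩,
    fun n hn => greekKeyCount_rec hn⟩
  rw [PowerSeries.eq_mul_inv_iff_mul_eq]
  · exact greekKeySeries_mul_denominator
  · simp
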